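/- Let $G$ be an abelian topological group and $X$ a complex Banach space. A set $E\subset G$ is relatively dense if $E+L=G$ for some compact $L\subset G$. For a Banach space $Y$, a function $f:G\to Y$ is called recurrent if it is continuous and if, for every compact $K\subset G$ and every $\varepsilon>0$, the set $\{\tau\in G:\ \|f(t+\tau)-f(t)\|\le\varepsilon \text{ for all } t\in K\}$ is relatively dense; $REC(G,Y)$ is the set of recurrent functions. Let $REC_{urc}(G,X)$ be the set of all $f\in REC(G,X)$ that are uniformly continuous and have relatively compact range. A set $U$ of functions $G\to X$ satisfies (3.2) if $$n\in\mathbb N=\{1,2,\dots\},\ f_1,\dots,f_n\in U \quad\text{implies}\quad (f_1,\dots,f_n)\in REC(G,X^n),$$ where $X^n$ carries the maximum norm. Let $\emptyset\ne V\subset REC_{urc}(G,X)$ satisfy (3.2). Then the family $$\{U:\ V\subset U\subset REC_{urc}(G,X),\ U \text{ satisfies (3.2)}\}$$ has a maximal element with respect to inclusion, and every such maximal element $\mathcal A$ (denoted $rec_{urc}V$, once one is fixed) is a $\lambda$-class. That is, $\mathcal A$ is a complex linear subspace of the space $C_{ub}(G,X)$ of bounded uniformly continuous functions, closed under uniform convergence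 on $G$ and containing all constant functions. For all $f\in\mathcal A$ and $s\in G$ the translate $t\mapsto f(t+s)$ belongs to $\mathcal A$. Finally, $\omega f\in\mathcal A$ for every $f\in\mathcal A$ and every continuous bounded character $\omega$ of $G$, i.e. every continuous bounded $\omega:G\to\mathbb C$, $\omega\not\equiv0$, with $\omega(s+t)=\omega(s)\omega(t)$ for all $s,t\in G$. -/

import Mathlib

open Set Filter Topology
open scoped Pointwise

namespace RecurrentFunctions

section Basic

variable {G : Type*} [AddCommGroup G] [TopologicalSpace G]
variable {X : Type*} [NormedAddCommGroup X]

/-- `E ⊆ G` is relatively dense: `E + L = G` for some compact `L ⊆ G`. -/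
def RelativelyDense (E : Set G) : Prop :=
  ∃ L : Set G, IsCompact L ∧ E + L = univ

/-- The set `E(f, ε, K)` of `ε`-`K`-periods of `f`. -/
def periods (f : G → X) (ε : ℝ) (K : Set G) : Set G :=
  {τ | ∀ t ∈ K, ‖f (t + τ) - f t‖ ≤ ε}

/-- `f` is recurrent: it is continuous and, for each `ε > 0` and each compact `K`, its set of
`ε`-`K`-periods is relatively dense. -/
def Recurrent (f : G → X) : Prop :=
  Continuous f ∧ ∀ K : Set G, IsCompact K → ∀ ε : ℝ, 0 < ε → RelativelyDense (periods f ε K)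

/-- Every finite tuple of members of `U` (repetitions allowed) is recurrent as a function with
values in `X ^ n` (with the maximum norm). -/
def JointlyRecurrent (U : Set (G → X)) : Prop :=
  ∀ n : ℕ, 1 ≤ n → ∀ f : Fin n → G → X, (∀ i, f i ∈ U) →
    Recurrent (fun (t : G) (i : Fin n) => f i t)

variable (G X) in
/-- `C_u(G, X)`: the uniformly continuous functions, for the group uniformity of `G`. -/
def Cu [IsTopologicalAddGroup G] : Set (G → X) :=
  {f | @UniformContinuous G X (IsTopologicalAddGroup.rightUniformSpace G) _ f}

variable (G X) in
/-- `C_b(G, X)`: the bounded continuous functions. -/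
def Cb : Set (G → X) :=
  {f | Continuous f ∧ ∃ C : ℝ, ∀ t, ‖f t‖ ≤ C}

variable (G X) in
/-- `C_rc(G, X)`: the continuous functions with relatively compact range. -/
def Crc : Set (G → X) :=
  {f | Continuous f ∧ IsCompact (closure (range f))}

variable (G X) in
/-- `REC_urc(G, X)`: the recurrent, uniformly continuous functions with relatively compact
range. -/
def RecUrc [IsTopologicalAddGroup G] : Set (G → X) :=
  {f | Recurrent f} ∩ (Cu G X ∩ Crc G X)

/-- The family of all `U` with `V ⊆ U ⊆ REC_urc(G, X)` all of whose finite tuples are recurrent,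
to be ordered by inclusion. -/
def recFamily [IsTopologicalAddGroup G] (V : Set (G → X)) : Set (Set (G → X)) :=
  {U | U ⊆ RecUrc G X ∧ V ⊆ U ∧ JointlyRecurrent U}

/-- `L` is an admissible choice of `rec_urc V`: a maximal element, with respect to inclusion,
of `recFamily V`. -/
def IsRecUrc [IsTopologicalAddGroup G] (V L : Set (G → X)) : Prop :=
  Maximal (fun U : Set (G → X) => U ∈ recFamily V) L

/-- `ω` is a continuous bounded character `G → ℂ` (the condition at `0` only excludes the zero
function). -/
structure IsBoundedCharacter (ω : G → ℂ) : Prop where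
  continuous : Continuous ω
  bounded : ∃ C : ℝ, ∀ t, ‖ω t‖ ≤ C
  map_zero : ω 0 = 1
  map_add : ∀ s t, ω (s + t) = ω s * ω t

end Basic

/-- `A` is a `λ`-class: a translation invariant, closed linear subspace of `C_ub(G, X)` that
contains the constants and is stable under multiplication by continuous bounded characters. -/
structure IsLambdaClass {G : Type*} [AddCommGroup G] [TopologicalSpace G]
    [IsTopologicalAddGroup G] {X : Type*} [NormedAddCommGroup X] [NormedSpace ℂ X]
    (A : Set (G → X)) : Prop where
  subset_Cub : A ⊆ Cu G X ∩ Cb G X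
  const_mem : ∀ x : X, (fun _ : G => x) ∈ A
  add_mem : ∀ f ∈ A, ∀ g ∈ A, (fun t => f t + g t) ∈ A
  smul_mem : ∀ c : ℂ, ∀ f ∈ A, (fun t => c • f t) ∈ A
  translate_mem : ∀ f ∈ A, ∀ s : G, (fun t => f (t + s)) ∈ A
  uniformly_closed : ∀ (F : ℕ → G → X) (f : G → X), (∀ k, F k ∈ A) →
    TendstoUniformly F f atTop → f ∈ A
  character_smul_mem : ∀ f ∈ A, ∀ ω : G → ℂ, IsBoundedCharacter ω → (fun t => ω t • f t) ∈ A

end RecurrentFunctions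

/-! Zorn's lemma gives a maximal `L`: a finite tuple from the union of a chain lies in one member.
Maximality then turns membership of `g` in `L` into a period estimate: the common periods of `g`
with any finite nonempty subfamily of `L` must be relatively dense
(`IsRecUrc.mem_of_relativelyDense`). For constants, sums, multiples, translates and uniform limits,
common periods of finitely many members of `L`, on suitable compact sets, are already periods of `g`
(`IsRecUrc.mem_of_commonPeriods_subset`).

For `ω f` one needs common periods `τ` with `ω τ` near `1`. If values of `ω` at ever finer common
periods cluster at `z`, they also cluster at every power of `z`, and in a compact group these powers
come back near `z⁻¹`. So a fixed common period `σ` with `ω σ` near `z⁻¹` corrects every `τ` with `ω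
τ` near `z`. By compactness finitely many `σ` suffice, and finitely many shifts preserve relative
density. -/

namespace RecurrentFunctions

/-! ### Common periods and their values under a homomorphism -/

section Periods

variable {G : Type*} [AddCommGroup G] {X : Type*} [NormedAddCommGroup X]

/-- The common `ε`-`K`-periods of the functions in `S`. -/
def commonPeriods (S : Set (G → X)) (ε : ℝ) (K : Set G) : Set G :=
  {τ | ∀ f ∈ S, τ ∈ periods f ε K}

theorem commonPeriods_mono {S T : Set (G → X)} {ε δ : ℝ} {K K' : Set G} (hST : S ⊆ T)
    (hδ : δ ≤ ε) (hK : K ⊆ K') : commonPeriods T δ K' ⊆ commonPeriods S ε K :=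
  fun _ hτ f hf t ht => (hτ f (hST hf) t (hK ht)).trans hδ

theorem zero_mem_commonPeriods (S : Set (G → X)) {ε : ℝ} (hε : 0 < ε) (K : Set G) :
    0 ∈ commonPeriods S ε K := fun f _ t _ => by simpa using hε.le

/-- If `σ` is a common period, and `τ` is a common period on a set containing `K` translated
by `σ`, then `τ + σ` is a common period. -/
theorem add_mem_commonPeriods {S : Set (G → X)} {ε δ : ℝ} {K K' : Set G} {σ τ : G}
    (hσ : σ ∈ commonPeriods S ε K) (hτ : τ ∈ commonPeriods S δ K')
    (hK : ∀ t ∈ K, t + σ ∈ K') : τ + σ ∈ commonPeriods S (δ + ε) K := by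
  intro f hf t ht
  have h₁ := hτ f hf (t + σ) (hK t ht)
  have h₂ := hσ f hf t ht
  have h₃ := norm_sub_le_norm_sub_add_norm_sub (f (t + (τ + σ))) (f (t + σ)) (f t)
  rw [show t + (τ + σ) = t + σ + τ by abel] at h₃ ⊢
  linarith

theorem periods_pi {n : ℕ} (f : Fin n → G → X) {ε : ℝ} (hε : 0 ≤ ε) (K : Set G) :
    periods (fun t i => f i t) ε K = commonPeriods (range f) ε K := by
  ext τ
  simp only [periods, commonPeriods, mem_ofPred_eq, forall_mem_range, pi_norm_le_iff_of_nonneg hε,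
    Pi.sub_apply]
  exact ⟨fun h i t ht => h t ht i, fun h t ht i => h i t ht⟩

variable [TopologicalSpace G]

theorem RelativelyDense.mono {E F : Set G} (hE : RelativelyDense E) (h : E ⊆ F) :
    RelativelyDense F := by
  obtain ⟨L, hL, hEL⟩ := hE
  exact ⟨L, hL, eq_univ_of_univ_subset (hEL ▸ add_subset_add_right h)⟩

/-- A set that meets every finite translate `τ + S`, with `τ` in a relatively dense set, is
relatively dense. -/
theorem RelativelyDense.of_forall_exists_add_mem [IsTopologicalAddGroup G] {E F S : Set G}
    (hE : RelativelyDense E) (hS : S.Finite) (h : ∀ τ ∈ E, ∃ σ ∈ S, τ + σ ∈ F) :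
    RelativelyDense F := by
  obtain ⟨L, hL, hEL⟩ := hE
  refine ⟨L - S, sub_eq_add_neg L S ▸ hL.add hS.isCompact.neg, eq_univ_of_forall fun g => ?_⟩
  obtain ⟨τ, hτ, l, hl, rfl⟩ : g ∈ E + L := hEL ▸ mem_univ g
  obtain ⟨σ, hσ, hF⟩ := h τ hτ
  exact ⟨τ + σ, hF, l - σ, ⟨l, hl, σ, hσ, rfl⟩, by simp⟩

theorem JointlyRecurrent.relativelyDense_commonPeriods {U : Set (G → X)}
    (hU : JointlyRecurrent U) {S : Set (G → X)} (hS : S.Finite) (hne : S.Nonempty) (hSU : S ⊆ U)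
    {ε : ℝ} (hε : 0 < ε) {K : Set G} (hK : IsCompact K) :
    RelativelyDense (commonPeriods S ε K) := by
  obtain ⟨n, f, hf⟩ := hS.fin_param
  obtain ⟨-, rfl⟩ := hf
  have hn : 1 ≤ n := by
    obtain ⟨_, i, -⟩ := hne
    exact i.pos
  rw [← periods_pi f hε.le]
  exact (hU n hn f fun i => hSU (mem_range_self i)).2 K hK ε hε

theorem jointlyRecurrent_of_commonPeriods {U : Set (G → X)} (hc : ∀ f ∈ U, Continuous f)
    (h : ∀ S ⊆ U, S.Finite → ∀ K, IsCompact K → ∀ ε : ℝ, 0 < ε →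
      RelativelyDense (commonPeriods S ε K)) : JointlyRecurrent U := by
  refine fun n _ f hf => ⟨continuous_pi fun i => hc _ (hf i), fun K hK ε hε => ?_⟩
  rw [periods_pi f hε.le]
  exact h _ (range_subset_iff.2 hf) (finite_range f) K hK ε hε

variable [IsTopologicalAddGroup G]

/-- Values in a compact group of a homomorphism at common periods can be moved close to `1` by
adding one of finitely many common periods. -/
theorem exists_finite_commonPeriods_map_add_mem {H : Type*} [Group H] [TopologicalSpace H]
    [IsTopologicalGroup H] [CompactSpace H] {ω : G → H} (hω₀ : ω 0 = 1)
    (hω : ∀ s t, ω (s + t) = ω s * ω t) (S : Set (G → X)) {K : Set G} (hK : IsCompact K) {ε : ℝ}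
    (hε : 0 < ε) {W : Set H} (hW : W ∈ 𝓝 1) :
    ∃ T : Set G, T.Finite ∧ T ⊆ commonPeriods S ε K ∧ ∃ K' : Set G, IsCompact K' ∧
      ∃ δ : ℝ, 0 < δ ∧ ∀ τ ∈ commonPeriods S δ K', ∃ σ ∈ T, ω (τ + σ) ∈ W := by
  -- Compactness induction on `H`: `P A` says that finitely many corrections handle all sufficiently
  -- fine `τ` with `ω τ ∈ A`. It remains to check `P` near each point `z`.
  let P : Set H → Prop := fun A =>
    ∃ T : Set G, T.Finite ∧ T ⊆ commonPeriods S ε K ∧ ∃ K' : Set G, IsCompact K' ∧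
      ∃ δ : ℝ, 0 < δ ∧ ∀ τ ∈ commonPeriods S δ K', ω τ ∈ A → ∃ σ ∈ T, ω (τ + σ) ∈ W
  suffices h : P univ by simpa [P] using h
  refine isCompact_univ.induction_on (p := P) ?_ ?_ ?_ ?_
  · exact ⟨∅, finite_empty, empty_subset _, ∅, isCompact_empty, 1, one_pos, by simp⟩
  · rintro A B hAB ⟨T, hT, hTE, K', hK', δ, hδ, h⟩
    exact ⟨T, hT, hTE, K', hK', δ, hδ, fun τ hτ hA => h τ hτ (hAB hA)⟩
  · rintro A B ⟨T, hT, hTE, K', hK', δ, hδ, h⟩ ⟨T', hT', hTE', K'', hK'', δ', hδ', h'⟩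
    refine ⟨T ∪ T', hT.union hT', union_subset hTE hTE', K' ∪ K'', hK'.union hK'', min δ δ',
      lt_min hδ hδ', ?_⟩
    rintro τ hτ (hA | hB)
    · obtain ⟨σ, hσ, hσW⟩ :=
        h τ (commonPeriods_mono subset_rfl (min_le_left _ _) subset_union_left hτ) hA
      exact ⟨σ, Or.inl hσ, hσW⟩
    · obtain ⟨σ, hσ, hσW⟩ :=
        h' τ (commonPeriods_mono subset_rfl (min_le_right _ _) subset_union_right hτ) hB
      exact ⟨σ, Or.inr hσ, hσW⟩
  intro z _
  by_cases hz : ∀ U ∈ 𝓝 z, ∀ K' : Set G, IsCompact K' → ∀ δ : ℝ, 0 < δ →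
      ∃ τ ∈ commonPeriods S δ K', ω τ ∈ U
  -- Here `z` is a cluster value. Cluster values are stable under multiplication by `z`: choose `σ`
  -- first, then `τ` fine on `K' + {σ}`, and use `τ + σ`.
  · have hpow : ∀ n : ℕ, ∀ U ∈ 𝓝 (z ^ n), ∀ K' : Set G, IsCompact K' → ∀ δ : ℝ, 0 < δ →
        ∃ τ ∈ commonPeriods S δ K', ω τ ∈ U := by
      intro n
      induction n with
      | zero =>
        intro U hU K' _ δ hδ
        refine ⟨0, zero_mem_commonPeriods S hδ K', ?_⟩
        rw [hω₀, ← pow_zero z]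
        exact mem_of_mem_nhds hU
      | succ n ih =>
        intro U hU K' hK' δ hδ
        rw [pow_succ'] at hU
        have hmul : Tendsto (fun p : H × H => p.1 * p.2) (𝓝 z ×ˢ 𝓝 (z ^ n)) (𝓝 (z * z ^ n)) :=
          tendsto_fst.mul tendsto_snd
        obtain ⟨A, hA, B, hB, hAB⟩ := mem_prod_iff.1 (hmul hU)
        obtain ⟨σ, hσ, hσB⟩ := ih B hB K' hK' (δ / 2) (half_pos hδ)
        obtain ⟨τ, hτ, hτA⟩ := hz A hA (K' + {σ}) (hK'.add isCompact_singleton) (δ / 2)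
          (half_pos hδ)
        refine ⟨τ + σ, ?_, ?_⟩
        · rw [← add_halves δ]
          exact add_mem_commonPeriods hσ hτ fun t ht => add_mem_add ht rfl
        · rw [hω]
          exact hAB (mk_mem_prod hτA hσB)
    have hmul : Tendsto (fun p : H × H => p.1 * p.2) (𝓝 z ×ˢ 𝓝 z⁻¹) (𝓝 1) := by
      simpa using (tendsto_fst (f := 𝓝 z) (g := 𝓝 z⁻¹)).mul tendsto_snd
    obtain ⟨A, hA, B, hB, hAB⟩ := mem_prod_iff.1 (hmul hW)
    -- In a compact group `z⁻¹` is a cluster point of the positive powers of `z`.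
    have hclus := mapClusterPt_self_zpow_atTop_pow z (-1)
    rw [zpow_neg_one, mapClusterPt_iff_frequently] at hclus
    obtain ⟨n, hn⟩ := (hclus (interior B) (interior_mem_nhds.2 hB)).exists
    obtain ⟨σ, hσ, hσB⟩ := hpow n (interior B) (isOpen_interior.mem_nhds hn) K hK ε hε
    refine ⟨A, mem_nhdsWithin_of_mem_nhds hA, {σ}, finite_singleton σ, singleton_subset_iff.2 hσ,
      ∅, isCompact_empty, 1, one_pos, fun τ _ hτ => ⟨σ, rfl, ?_⟩⟩
    rw [hω]
    exact hAB (mk_mem_prod hτ (interior_subset hσB))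
  -- If `z` is not a cluster value, no sufficiently fine `τ` has `ω τ` near `z`, so `T = ∅` works
  -- vacuously.
  · push Not at hz
    obtain ⟨U, hU, K', hK', δ, hδ, h⟩ := hz
    exact ⟨U, mem_nhdsWithin_of_mem_nhds hU, ∅, finite_empty, empty_subset _, K', hK', δ, hδ,
      fun τ hτ hτU => absurd hτU (h τ hτ)⟩

/-- Common periods of a jointly recurrent family at which a homomorphism to a compact group is
close to `1` are relatively dense. -/
theorem JointlyRecurrent.relativelyDense_commonPeriods_inter_preimage {H : Type*} [Group H]
    [TopologicalSpace H] [IsTopologicalGroup H] [CompactSpace H] {ω : G → H} (hω₀ : ω 0 = 1)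
    (hω : ∀ s t, ω (s + t) = ω s * ω t) {U : Set (G → X)}
    (hU : JointlyRecurrent U) {S : Set (G → X)} (hS : S.Finite) (hne : S.Nonempty) (hSU : S ⊆ U)
    {ε : ℝ} (hε : 0 < ε) {K : Set G} (hK : IsCompact K) {W : Set H} (hW : W ∈ 𝓝 1) :
    RelativelyDense (commonPeriods S ε K ∩ ω ⁻¹' W) := by
  obtain ⟨T, hT, hTE, K', hK', δ, hδ, h⟩ :=
    exists_finite_commonPeriods_map_add_mem hω₀ hω S hK (half_pos hε) hW
  -- The set `K + T` is included because `τ` acts on `K` already shifted by some `σ ∈ T`.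
  have hrd := hU.relativelyDense_commonPeriods hS hne hSU (lt_min hδ (half_pos hε))
    (hK'.union (hK.add hT.isCompact))
  refine hrd.of_forall_exists_add_mem hT fun τ hτ => ?_
  obtain ⟨σ, hσ, hσW⟩ :=
    h τ (commonPeriods_mono subset_rfl (min_le_left _ _) subset_union_left hτ)
  refine ⟨σ, hσ, ?_, hσW⟩
  rw [← add_halves ε]
  exact add_mem_commonPeriods (hTE hσ)
    (commonPeriods_mono subset_rfl (min_le_right _ _) subset_rfl hτ)
    fun t ht => Or.inr (add_mem_add ht hσ)

end Periods

/-! ### Relatively compact ranges -/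

section Range

variable {G : Type*} {X : Type*} [NormedAddCommGroup X]

theorem mem_closure_range (f : G → X) (t : G) : f t ∈ closure (range f) :=
  subset_closure (mem_range_self t)

variable [TopologicalSpace G]

theorem exists_norm_le_of_mem_Crc {f : G → X} (hf : f ∈ Crc G X) : ∃ C : ℝ, ∀ t, ‖f t‖ ≤ C := by
  obtain ⟨C, hC⟩ := hf.2.isBounded.exists_norm_le
  exact ⟨C, fun t => hC _ (subset_closure (mem_range_self t))⟩

theorem mem_Crc_of_forall_mem {f : G → X} (hf : Continuous f) {A : Set X} (hA : IsCompact A)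
    (h : ∀ t, f t ∈ A) : f ∈ Crc G X :=
  ⟨hf, hA.closure_of_subset (range_subset_iff.2 h)⟩

theorem Crc.of_tendstoUniformly [CompleteSpace X] {F : ℕ → G → X} {f : G → X}
    (hF : ∀ k, F k ∈ Crc G X) (h : TendstoUniformly F f atTop) : f ∈ Crc G X := by
  refine ⟨h.continuous (Eventually.of_forall fun k => (hF k).1).frequently, ?_⟩
  refine TotallyBounded.isCompact_of_isClosed (TotallyBounded.closure ?_) isClosed_closure
  refine Metric.totallyBounded_iff.2 fun ε hε => ?_
  obtain ⟨k, hk⟩ := (Metric.tendstoUniformly_iff.1 h (ε / 2) (half_pos hε)).exists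
  obtain ⟨T, hT, hsub⟩ := Metric.totallyBounded_iff.1 (hF k).2.totallyBounded (ε / 2) (half_pos hε)
  refine ⟨T, hT, range_subset_iff.2 fun t => ?_⟩
  obtain ⟨y, hy, hty⟩ := mem_iUnion₂.1 (hsub (mem_closure_range (F k) t))
  refine mem_iUnion₂.2 ⟨y, hy, ?_⟩
  have := dist_triangle (f t) (F k t) y
  have := hk t
  rw [Metric.mem_ball] at hty ⊢
  linarith

end Range

/-! ### Existence of maximal families and membership criteria -/

section Maximal

variable {G : Type*} [AddCommGroup G] [TopologicalSpace G] [IsTopologicalAddGroup G]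
variable {X : Type*} [NormedAddCommGroup X]

theorem exists_isRecUrc {V : Set (G → X)} (hVrec : V ⊆ RecUrc G X) (hVjoint : JointlyRecurrent V) :
    ∃ L : Set (G → X), IsRecUrc V L := by
  refine (zorn_subset_nonempty (recFamily V) (fun c hc hchain hne => ?_) V
    ⟨hVrec, subset_rfl, hVjoint⟩).imp fun _ => And.right
  refine ⟨⋃₀ c, ⟨sUnion_subset fun s hs => (hc hs).1, ?_, ?_⟩, fun s => subset_sUnion_of_mem⟩
  · obtain ⟨s, hs⟩ := hne
    exact (hc hs).2.1.trans (subset_sUnion_of_mem hs)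
  · intro n hn f hf
    obtain ⟨s, hs, hfs⟩ := hchain.directedOn.exists_mem_subset_of_finite_of_subset_sUnion hne
      (finite_range f) (range_subset_iff.2 hf)
    exact (hc hs).2.2 n hn f (range_subset_iff.1 hfs)

/-- A uniformly continuous function with relatively compact range belongs to a maximal jointly
recurrent family as soon as it is jointly recurrent with all finite nonempty subfamilies. -/
theorem IsRecUrc.mem_of_relativelyDense {V L : Set (G → X)} (hL : IsRecUrc V L)
    (hV : V.Nonempty) {g : G → X} (hgu : g ∈ Cu G X) (hgc : g ∈ Crc G X)
    (h : ∀ S ⊆ L, S.Finite → S.Nonempty → ∀ K, IsCompact K → ∀ ε : ℝ, 0 < ε →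
      RelativelyDense (commonPeriods S ε K ∩ periods g ε K)) : g ∈ L := by
  obtain ⟨f₀, hf₀⟩ := hV
  replace hf₀ := hL.prop.2.1 hf₀
  have hgr : Recurrent g := ⟨hgc.1, fun K hK ε hε =>
    (h {f₀} (singleton_subset_iff.2 hf₀) (finite_singleton _) (singleton_nonempty _) K hK ε
      hε).mono inter_subset_right⟩
  have hins : insert g L ∈ recFamily V := by
    refine ⟨insert_subset ⟨hgr, hgu, hgc⟩ hL.prop.1, hL.prop.2.1.trans (subset_insert g L), ?_⟩
    refine jointlyRecurrent_of_commonPeriods ?_ fun S hS hfin K hK ε hε => ?_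
    · rintro f (rfl | hf)
      exacts [hgc.1, (hL.prop.1 hf).1.1]
    -- Inserting `f₀` keeps the subfamily nonempty even when `S ⊆ {g}`.
    · refine (h (insert f₀ (S ∩ L)) (insert_subset hf₀ inter_subset_right)
        ((hfin.subset inter_subset_left).insert _) (insert_nonempty _ _) K hK ε hε).mono ?_
      rintro τ ⟨hτ, hτg⟩ f hf
      rcases hS hf with rfl | hfL
      exacts [hτg, hτ f (Or.inr ⟨hf, hfL⟩)]
  exact hL.le_of_ge hins (subset_insert g L) (mem_insert g L)

theorem IsRecUrc.mem_of_commonPeriods_subset {V L : Set (G → X)} (hL : IsRecUrc V L)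
    (hV : V.Nonempty) {g : G → X} (hgu : g ∈ Cu G X) (hgc : g ∈ Crc G X)
    (h : ∀ K, IsCompact K → ∀ ε : ℝ, 0 < ε → ∃ T ⊆ L, T.Finite ∧ ∃ K', IsCompact K' ∧
      ∃ δ : ℝ, 0 < δ ∧ commonPeriods T δ K' ⊆ periods g ε K) : g ∈ L := by
  refine hL.mem_of_relativelyDense hV hgu hgc fun S hS hfin hne K hK ε hε => ?_
  obtain ⟨T, hT, hTfin, K', hK', δ, hδ, hsub⟩ := h K hK ε hε
  refine (hL.prop.2.2.relativelyDense_commonPeriods (hfin.union hTfin) hne.inl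
    (union_subset hS hT) (lt_min hε hδ) (hK.union hK')).mono fun τ hτ => ⟨?_, hsub ?_⟩
  · exact commonPeriods_mono subset_union_left (min_le_left _ _) subset_union_left hτ
  · exact commonPeriods_mono subset_union_right (min_le_right _ _) subset_union_right hτ

theorem isUniformAddGroup_rightUniformSpace :
    @IsUniformAddGroup G (IsTopologicalAddGroup.rightUniformSpace G) _ :=
  isUniformAddGroup_of_addCommGroup

end Maximal

/-! ### Multiplication by characters -/

section Character

variable {G : Type*} [AddCommGroup G] [TopologicalSpace G]

/-- If `‖ω t‖ > 1`, the powers `ω (n • t)` would be unbounded; the bound at `-t` gives the reverse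
inequality. -/
theorem IsBoundedCharacter.norm_eq_one {ω : G → ℂ} (hω : IsBoundedCharacter ω) (t : G) :
    ‖ω t‖ = 1 := by
  have hle : ∀ t, ‖ω t‖ ≤ 1 := by
    intro t
    by_contra! hlt
    obtain ⟨C, hC⟩ := hω.bounded
    obtain ⟨n, hn⟩ := pow_unbounded_of_one_lt C hlt
    have hpow : ω (n • t) = ω t ^ n := by
      clear hn
      induction n with
      | zero => simpa using hω.map_zero
      | succ n ih => rw [succ_nsmul, hω.map_add, ih, pow_succ]
    have := hC (n • t)
    rw [hpow, norm_pow] at this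
    linarith
  refine (hle t).antisymm ?_
  have h : ‖ω t‖ * ‖ω (-t)‖ = 1 := by
    rw [← norm_mul, ← hω.map_add, add_neg_cancel, hω.map_zero, norm_one]
  nlinarith [hle (-t), norm_nonneg (ω t)]

theorem IsBoundedCharacter.norm_sub {ω : G → ℂ} (hω : IsBoundedCharacter ω) (s t : G) :
    ‖ω s - ω t‖ = ‖ω (s - t) - 1‖ := by
  have h : ω s - ω t = (ω (s - t) - 1) * ω t := by
    rw [sub_mul, ← hω.map_add, sub_add_cancel, one_mul]
  rw [h, norm_mul, hω.norm_eq_one, mul_one]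

variable [IsTopologicalAddGroup G]

theorem IsBoundedCharacter.mem_Cu {ω : G → ℂ} (hω : IsBoundedCharacter ω) : ω ∈ Cu G ℂ := by
  let _ := IsTopologicalAddGroup.rightUniformSpace G
  have := isUniformAddGroup_rightUniformSpace (G := G)
  change UniformContinuous ω
  rw [UniformContinuous, Metric.uniformity_basis_dist.tendsto_right_iff]
  intro ε hε
  rw [uniformity_eq_comap_nhds_zero_swapped]
  have h : ∀ᶠ s in 𝓝 (0 : G), ‖ω s - 1‖ < ε := by
    have := (hω.continuous.tendsto 0).eventually (Metric.ball_mem_nhds _ hε)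
    simpa [hω.map_zero, dist_eq_norm] using this
  filter_upwards [preimage_mem_comap h] with p hp
  simpa [dist_eq_norm, hω.norm_sub p.1 p.2] using hp

variable {X : Type*} [NormedAddCommGroup X] [NormedSpace ℂ X]

theorem IsBoundedCharacter.smul_mem_Cu {ω : G → ℂ} (hω : IsBoundedCharacter ω) {f : G → X}
    (hf : f ∈ Cu G X) (hfb : ∃ C : ℝ, ∀ t, ‖f t‖ ≤ C) : (fun t => ω t • f t) ∈ Cu G X := by
  let _ := IsTopologicalAddGroup.rightUniformSpace G
  obtain ⟨C, hC⟩ := hfb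
  have hu : UniformContinuous ω := hω.mem_Cu
  change UniformContinuous f at hf
  change UniformContinuous fun t => ω t • f t
  have hC' : 0 < |C| + 1 := by positivity
  rw [UniformContinuous, Metric.uniformity_basis_dist.tendsto_right_iff] at hf hu ⊢
  intro ε hε
  filter_upwards [hf (ε / 2) (half_pos hε), hu (ε / 2 / (|C| + 1)) (by positivity)] with p h₁ h₂
  simp only [dist_eq_norm] at h₁ h₂ ⊢
  rw [lt_div_iff₀ hC'] at h₂
  calc ‖ω p.1 • f p.1 - ω p.2 • f p.2‖
      = ‖ω p.1 • (f p.1 - f p.2) + (ω p.1 - ω p.2) • f p.2‖ := by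
        congr 1; rw [smul_sub, sub_smul]; abel
    _ ≤ ‖f p.1 - f p.2‖ + ‖ω p.1 - ω p.2‖ * ‖f p.2‖ := by
        refine (norm_add_le _ _).trans_eq ?_
        rw [norm_smul, norm_smul, hω.norm_eq_one, one_mul]
    _ ≤ ‖f p.1 - f p.2‖ + ‖ω p.1 - ω p.2‖ * (|C| + 1) := by
        gcongr
        linarith [hC p.2, le_abs_self C]
    _ < ε := by linarith

theorem IsRecUrc.character_smul_mem {V L : Set (G → X)} (hL : IsRecUrc V L) (hV : V.Nonempty)
    {f : G → X} (hf : f ∈ L) {ω : G → ℂ} (hω : IsBoundedCharacter ω) :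
    (fun t => ω t • f t) ∈ L := by
  obtain ⟨-, hfu, hfc⟩ := hL.prop.1 hf
  obtain ⟨C, hC⟩ := exists_norm_le_of_mem_Crc hfc
  refine hL.mem_of_relativelyDense hV (hω.smul_mem_Cu hfu ⟨C, hC⟩)
    (mem_Crc_of_forall_mem (hω.continuous.smul hfc.1)
      ((isCompact_sphere (0 : ℂ) 1).smul_set hfc.2) fun t =>
        smul_mem_smul (by simp [hω.norm_eq_one]) (mem_closure_range f t)) ?_
  intro S hS hfin _ K hK ε hε
  let χ : G → Circle := fun t => ⟨ω t, by simp [Submonoid.unitSphere, hω.norm_eq_one]⟩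
  have hC' : 0 < |C| + 1 := by positivity
  have hW : {z : Circle | ‖(z : ℂ) - 1‖ < ε / 2 / (|C| + 1)} ∈ 𝓝 (1 : Circle) := by
    refine IsOpen.mem_nhds (isOpen_lt (by fun_prop) continuous_const) ?_
    simp only [mem_ofPred_eq, Circle.coe_one, sub_self, norm_zero]
    positivity
  -- Adjoining `f` to `S` controls the increment of `f`; closeness of `ω τ` to `1` controls that of
  -- `ω`.
  refine (hL.prop.2.2.relativelyDense_commonPeriods_inter_preimage (ω := χ)
    (Circle.ext hω.map_zero) (fun s t => Circle.ext (hω.map_add s t)) (hfin.insert f)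
    (insert_nonempty _ _) (insert_subset hf hS) (half_pos hε) hK hW).mono ?_
  rintro τ ⟨hτ, hτW⟩
  refine ⟨commonPeriods_mono (subset_insert _ _) (half_le_self hε.le) subset_rfl hτ,
    fun t ht => ?_⟩
  have h₁ := hτ f (mem_insert _ _) t ht
  have h₂ : ‖ω τ - 1‖ < ε / 2 / (|C| + 1) := hτW
  rw [lt_div_iff₀ hC'] at h₂
  calc ‖ω (t + τ) • f (t + τ) - ω t • f t‖
      = ‖ω (t + τ) • (f (t + τ) - f t) + (ω (t + τ) - ω t) • f t‖ := by
        congr 1; rw [smul_sub, sub_smul]; abel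
    _ ≤ ‖f (t + τ) - f t‖ + ‖ω τ - 1‖ * ‖f t‖ := by
        refine (norm_add_le _ _).trans_eq ?_
        rw [norm_smul, norm_smul, hω.norm_eq_one, one_mul, hω.norm_sub, add_sub_cancel_left]
    _ ≤ ‖f (t + τ) - f t‖ + ‖ω τ - 1‖ * (|C| + 1) := by
        gcongr
        linarith [hC t, le_abs_self C]
    _ ≤ ε := by linarith

end Character

/-! ### Remaining closure properties -/

section LambdaClass

variable {G : Type*} [AddCommGroup G] [TopologicalSpace G] [IsTopologicalAddGroup G]
variable {X : Type*} [NormedAddCommGroup X] {V L : Set (G → X)}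

theorem IsRecUrc.const_mem (hL : IsRecUrc V L) (hV : V.Nonempty) (x : X) :
    (fun _ : G => x) ∈ L := by
  let _ := IsTopologicalAddGroup.rightUniformSpace G
  refine hL.mem_of_commonPeriods_subset hV uniformContinuous_const
    (mem_Crc_of_forall_mem continuous_const (isCompact_singleton (x := x)) fun _ => rfl) ?_
  exact fun K _ ε hε => ⟨∅, empty_subset _, finite_empty, ∅, isCompact_empty, 1, one_pos,
    fun τ _ t _ => by simpa using hε.le⟩

theorem IsRecUrc.add_mem (hL : IsRecUrc V L) (hV : V.Nonempty) {f g : G → X} (hf : f ∈ L)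
    (hg : g ∈ L) : (fun t => f t + g t) ∈ L := by
  obtain ⟨-, hfu, hfc⟩ := hL.prop.1 hf
  obtain ⟨-, hgu, hgc⟩ := hL.prop.1 hg
  let _ := IsTopologicalAddGroup.rightUniformSpace G
  refine hL.mem_of_commonPeriods_subset hV (UniformContinuous.add hfu hgu)
    (mem_Crc_of_forall_mem (hfc.1.add hgc.1) (hfc.2.add hgc.2) fun t =>
      add_mem_add (mem_closure_range f t) (mem_closure_range g t)) fun K hK ε hε => ?_
  refine ⟨{f, g}, by simp [insert_subset_iff, hf, hg], by simp, K, hK, ε / 2, half_pos hε,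
    fun τ hτ t ht => ?_⟩
  have h₁ := hτ f (by simp) t ht
  have h₂ := hτ g (by simp) t ht
  have h₃ := norm_add_le (f (t + τ) - f t) (g (t + τ) - g t)
  rw [add_sub_add_comm]
  linarith

theorem IsRecUrc.smul_mem [NormedSpace ℂ X] (hL : IsRecUrc V L) (hV : V.Nonempty) (c : ℂ)
    {f : G → X} (hf : f ∈ L) : (fun t => c • f t) ∈ L := by
  obtain ⟨-, hfu, hfc⟩ := hL.prop.1 hf
  let _ := IsTopologicalAddGroup.rightUniformSpace G
  refine hL.mem_of_commonPeriods_subset hV (UniformContinuous.const_smul hfu c)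
    (mem_Crc_of_forall_mem (hfc.1.const_smul c) (hfc.2.smul c) fun t =>
      smul_mem_smul_set (mem_closure_range f t)) fun K hK ε hε => ?_
  -- The `+ 1` covers `c = 0`.
  refine ⟨{f}, by simp [hf], by simp, K, hK, ε / (‖c‖ + 1), by positivity,
    fun τ hτ t ht => ?_⟩
  have h₁ := hτ f rfl t ht
  rw [le_div_iff₀ (by positivity)] at h₁
  rw [← smul_sub, norm_smul]
  nlinarith [norm_nonneg (f (t + τ) - f t)]

theorem IsRecUrc.translate_mem (hL : IsRecUrc V L) (hV : V.Nonempty) {f : G → X} (hf : f ∈ L)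
    (s : G) : (fun t => f (t + s)) ∈ L := by
  obtain ⟨-, hfu, hfc⟩ := hL.prop.1 hf
  let _ := IsTopologicalAddGroup.rightUniformSpace G
  have := isUniformAddGroup_rightUniformSpace (G := G)
  refine hL.mem_of_commonPeriods_subset hV
    (UniformContinuous.comp hfu (uniformContinuous_id.add uniformContinuous_const))
    (mem_Crc_of_forall_mem (hfc.1.comp (continuous_add_const s)) hfc.2 fun t =>
      mem_closure_range f (t + s)) fun K hK ε hε => ?_
  refine ⟨{f}, by simp [hf], by simp, K + {s}, hK.add isCompact_singleton, ε, hε,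
    fun τ hτ t ht => ?_⟩
  have h := hτ f rfl (t + s) (add_mem_add ht rfl)
  rwa [add_right_comm] at h

theorem IsRecUrc.mem_of_tendstoUniformly [CompleteSpace X] (hL : IsRecUrc V L) (hV : V.Nonempty)
    {F : ℕ → G → X} {f : G → X} (hF : ∀ k, F k ∈ L) (h : TendstoUniformly F f atTop) :
    f ∈ L := by
  let _ := IsTopologicalAddGroup.rightUniformSpace G
  refine hL.mem_of_commonPeriods_subset hV
    (h.uniformContinuous (Eventually.of_forall fun k => (hL.prop.1 (hF k)).2.1).frequently)
    (Crc.of_tendstoUniformly (fun k => (hL.prop.1 (hF k)).2.2) h) fun K hK ε hε => ?_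
  have hε' : 0 < ε / 3 := by positivity
  obtain ⟨k, hk⟩ := (Metric.tendstoUniformly_iff.1 h (ε / 3) hε').exists
  refine ⟨{F k}, by simp [hF k], by simp, K, hK, ε / 3, hε', fun τ hτ t ht => ?_⟩
  have h₁ := hτ (F k) rfl t ht
  have h₂ := hk (t + τ)
  have h₃ := hk t
  rw [← dist_eq_norm] at h₁ ⊢
  rw [dist_comm] at h₃
  linarith [dist_triangle4 (f (t + τ)) (F k (t + τ)) (F k t) (f t)]

theorem IsRecUrc.isLambdaClass [NormedSpace ℂ X] [CompleteSpace X] (hL : IsRecUrc V L)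
    (hV : V.Nonempty) : IsLambdaClass L where
  subset_Cub _ hf := ⟨(hL.prop.1 hf).2.1, (hL.prop.1 hf).1.1,
    exists_norm_le_of_mem_Crc (hL.prop.1 hf).2.2⟩
  const_mem := hL.const_mem hV
  add_mem _ hf _ hg := hL.add_mem hV hf hg
  smul_mem c _ hf := hL.smul_mem hV c hf
  translate_mem _ hf s := hL.translate_mem hV hf s
  uniformly_closed _ _ hF h := hL.mem_of_tendstoUniformly hV hF h
  character_smul_mem _ hf _ hω := hL.character_smul_mem hV hf hω

end LambdaClass

end RecurrentFunctions

theorem corollary3p4 {G : Type*} [AddCommGroup G] [TopologicalSpace G] [IsTopologicalAddGroup G]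
    {X : Type*} [NormedAddCommGroup X] [NormedSpace ℂ X] [CompleteSpace X]
    (V : Set (G → X)) (hV : V.Nonempty) (hVrec : V ⊆ RecurrentFunctions.RecUrc G X)
    (hVjoint : RecurrentFunctions.JointlyRecurrent V) :
    (∃ L : Set (G → X), RecurrentFunctions.IsRecUrc V L) ∧
      ∀ L : Set (G → X), RecurrentFunctions.IsRecUrc V L →
        RecurrentFunctions.IsLambdaClass L :=
  ⟨RecurrentFunctions.exists_isRecUrc hVrec hVjoint, fun _ hL => hL.isLambdaClass hV⟩
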